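/- Let $n\ge 2$ and let $K\subset\mathbb{R}^n$ be a symmetric convex body, i.e. a compact convex set with nonempty interior such that $K=-K$. Suppose that $K$ is 1-symmetric, i.e. invariant under all reflections in the coordinate hyperplanes and under all permutations of the coordinates. Let $x^1,\dots,x^n$ be independent random points, each uniformly distributed in $K$, and let $$V_K=\frac{1}{|K|}\,\bigl|\operatorname{conv}\{\pm x^1,\dots,\pm x^n\}\bigr|,$$ where $|\cdot|$ denotes volume in $\mathbb{R}^n$. Then $\int_K x_1^2x_2^2\,dx>0$, $V_K^4$ is integrable, and $$\mathbb{E} V_K^4=\frac{16^n (n+1)(n+2)}{2(n!)^2|K|^{n+4}}\left(\int_K x_1^2x_2^2\,dx\right)^n\varphi(A_K-3,n),$$ where $$\varphi(t,n)=\left(1-\frac{2t}{n+2}+\frac{t^2}{(n+1)(n+2)}\right)\sum_{k=0}^n\frac{t^k}{k!}+\frac{t^{n+1}}{(n+1)!}-\frac{t^{n+2}}{(n+2)!}$$ (with $t^0=1$ for every real $t$) and $$A_K=\frac{\int_K x_1^4\,dx}{\int_K x_1^2x_2^2\,dx}.$$ -/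

import Mathlib

open MeasureTheory ProbabilityTheory

noncomputable section

/-- Symmetric convex bodies in `ℝⁿ`: compact convex sets with interior points such that
`K = -K`. -/
structure IsSymmConvexBody {n : ℕ} (K : Set (EuclideanSpace ℝ (Fin n))) : Prop where
  convex : Convex ℝ K
  isCompact : IsCompact K
  interior_nonempty : (interior K).Nonempty
  neg_eq : (fun x => -x) '' K = K

/-- Reflection in the `i`-th coordinate hyperplane. -/
def coordReflect {n : ℕ} (i : Fin n) (x : EuclideanSpace ℝ (Fin n)) :
    EuclideanSpace ℝ (Fin n) :=
  WithLp.toLp 2 (fun j => if j = i then -x j else x j)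

/-- The permutation of coordinates given by `σ`. -/
def coordPermute {n : ℕ} (σ : Equiv.Perm (Fin n)) (x : EuclideanSpace ℝ (Fin n)) :
    EuclideanSpace ℝ (Fin n) :=
  WithLp.toLp 2 (fun j => x (σ j))

/-- `K` is 1-symmetric: invariant under all reflections in the coordinate hyperplanes and all
permutations of the coordinates. -/
structure IsOneSymmetric {n : ℕ} (K : Set (EuclideanSpace ℝ (Fin n))) : Prop where
  reflect_eq : ∀ i : Fin n, coordReflect i '' K = K
  permute_eq : ∀ σ : Equiv.Perm (Fin n), coordPermute σ '' K = K

/-- The normalized volume `|conv {± x₁, …, ± x_N}| / |K|`. -/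
def symmPolytopeVol {n N : ℕ} (K : Set (EuclideanSpace ℝ (Fin n)))
    (x : Fin N → EuclideanSpace ℝ (Fin n)) : ℝ :=
  volume.real (convexHull ℝ (Set.range x ∪ Set.range (fun i => -x i))) / volume.real K

/-- `∫_K x₁² x₂² dx`, in dimension `n ≥ 2` (coordinates are numbered from `0`). -/
def mixedMoment {n : ℕ} (hn : 2 ≤ n) (K : Set (EuclideanSpace ℝ (Fin n))) : ℝ :=
  ∫ x in K, x ⟨0, by omega⟩ ^ 2 * x ⟨1, by omega⟩ ^ 2

/-- `A_K = ∫_K x₁⁴ dx / ∫_K x₁² x₂² dx`. -/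
def momentRatio {n : ℕ} (hn : 2 ≤ n) (K : Set (EuclideanSpace ℝ (Fin n))) : ℝ :=
  (∫ x in K, x ⟨0, by omega⟩ ^ 4) / mixedMoment hn K

/-- The truncated-exponential expression `φ(t, n)`. -/
def truncExpPhi (t : ℝ) (n : ℕ) : ℝ :=
  (1 - 2 * t / ((n : ℝ) + 2) + t ^ 2 / (((n : ℝ) + 1) * ((n : ℝ) + 2))) *
      ∑ k ∈ Finset.range (n + 1), t ^ k / (Nat.factorial k : ℝ)
    + t ^ (n + 1) / (Nat.factorial (n + 1) : ℝ) - t ^ (n + 2) / (Nat.factorial (n + 2) : ℝ)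

end

/-! The polytope is a linear image of the `ℓ¹` ball, so its volume is `2^n / n!` times `|det|` of
the matrix with rows `x i`, and everything reduces to `E det⁴`. Expanding `det⁴` over quadruples of
permutations and using independence of the rows leaves products over `i` of fourth moments of one
row. By 1-symmetry such a moment with indices `a b c d` is, up to the factor `mixedMoment`, the sum
of the indicators of the three pairings plus `s = A_K - 3` times the indicator `a = b = c = d`
(`moment_four`). Multiplying out over `i` amounts to colouring the rows with these four patterns.
For a fixed colouring, an admissible quadruple is a common permutation times one permutation of each
of the three pairing classes, and its total sign is `+1`. So the signed sum is `n! c₀! c₁! c₂!`,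
where `c_j` is the size of class `j` (`sum_signProd_indexPattern`). Summed over colourings with
weight `s ^ c₃`, this is `(n!)²` times the coefficient of `X^n` in `e^{sX} (1 - X)⁻³`, which
`truncExpPhi` expresses in closed form. -/

/-! ### Exponential generating functions of colourings -/

/-- Summing a product of weights of fibre sizes over all colourings of `Fin n`. -/
lemma sum_prod_fiber_card {n : ℕ} {ι : Type*} [Fintype ι] [DecidableEq ι] (w : ι → ℕ → ℝ) :
    ∑ f : Fin n → ι, ∏ j, w j (Finset.univ.filter (fun i => f i = j)).card =
      n.factorial * PowerSeries.coeff n (∏ j, PowerSeries.mk fun k => w j k / k.factorial) := by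
  classical
  -- `L` replaces each monomial by its weight. Applied to the two expansions of `(∑ X_j)^n`, over
  -- words and over exponents, it gives the identity.
  let L : MvPolynomial ι ℝ →ₗ[ℝ] ℝ :=
    (MvPolynomial.basisMonomials ι ℝ).constr ℝ (fun m => ∏ j, w j (m j))
  have hL : ∀ k : ι → ℕ, L (∏ j, (MvPolynomial.X j : MvPolynomial ι ℝ) ^ k j) =
      ∏ j, w j (k j) := by
    intro k
    have h1 : (∏ j, (MvPolynomial.X j : MvPolynomial ι ℝ) ^ k j) =
        MvPolynomial.basisMonomials ι ℝ (Finsupp.equivFunOnFinite.symm k) := by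
      simp only [MvPolynomial.coe_basisMonomials]
      rw [MvPolynomial.monomial_eq, Finsupp.prod_fintype]
      · simp
      · simp
    rw [h1, Module.Basis.constr_basis]
    simp
  have h2 : ∑ f : Fin n → ι, ∏ i, (MvPolynomial.X (f i) : MvPolynomial ι ℝ) =
      (∑ j, MvPolynomial.X j) ^ n := by
    have := Finset.prod_univ_sum (fun _ : Fin n => (Finset.univ : Finset ι))
      (fun _ j => (MvPolynomial.X j : MvPolynomial ι ℝ))
    simpa using this.symm
  have h3 := congrArg L h2
  rw [Finset.sum_pow_eq_sum_piAntidiag, map_sum, map_sum] at h3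
  calc _ = ∑ f : Fin n → ι, L (∏ i, (MvPolynomial.X (f i) : MvPolynomial ι ℝ)) := by
        refine Finset.sum_congr rfl fun f _ => ?_
        rw [← hL, ← Finset.prod_fiberwise Finset.univ f]
        congr 1
        refine Finset.prod_congr rfl fun j _ => ?_
        rw [Finset.prod_congr rfl (g := fun _ => MvPolynomial.X j)]
        · simp
        · intro i hi
          simp at hi
          rw [hi]
    _ = _ := h3
    _ = ∑ k ∈ Finset.piAntidiag Finset.univ n,
          (n.factorial : ℝ) * ∏ j, (w j (k j) / (k j).factorial) := by
        refine Finset.sum_congr rfl fun k hk => ?_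
        have hs : ∑ j, k j = n := by simpa using hk
        have hm := Nat.multinomial_spec Finset.univ k
        rw [hs] at hm
        rw [← nsmul_eq_mul, map_nsmul, hL, nsmul_eq_mul, ← hm, Finset.prod_div_distrib]
        push_cast
        have : (∏ j, ((k j).factorial : ℝ)) ≠ 0 :=
          Finset.prod_ne_zero_iff.2 fun j _ => by positivity
        field_simp
    _ = _ := by
        rw [← Finset.mul_sum, PowerSeries.coeff_prod]
        congr 1
        refine Finset.sum_nbij' Finsupp.equivFunOnFinite.symm (fun f => ⇑f) ?_ ?_ ?_ ?_ ?_ <;>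
          simp [Finset.mem_finsuppAntidiag]

/-- The weights `k!` of colours 0, 1, 2 cancel the `1 / k!` of the exponential generating function,
so each of these colours contributes `1 / (1 - X)`; colour 3 contributes `e^{sX}`. The quadratic
factor is `(n - k + 2).choose 2`, the coefficient of `X^(n-k)` in `(1 - X)⁻³`. -/
lemma sum_fourColouring (n : ℕ) (s : ℝ) :
    ∑ f : Fin n → Fin 4, s ^ (Finset.univ.filter (fun i => f i = 3)).card *
        ((Finset.univ.filter (fun i => f i = 0)).card.factorial *
          (Finset.univ.filter (fun i => f i = 1)).card.factorial *
          (Finset.univ.filter (fun i => f i = 2)).card.factorial) =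
      n.factorial * ∑ k ∈ Finset.range (n + 1),
        s ^ k / k.factorial * (((n : ℝ) - k + 1) * ((n : ℝ) - k + 2) / 2) := by
  let w : Fin 4 → ℕ → ℝ := fun j k => if j = 3 then s ^ k else k.factorial
  have h := sum_prod_fiber_card (n := n) w
  have hl : (fun f : Fin n → Fin 4 => ∏ j, w j (Finset.univ.filter (fun i => f i = j)).card) =
      fun f => s ^ (Finset.univ.filter (fun i => f i = 3)).card *
        ((Finset.univ.filter (fun i => f i = 0)).card.factorial *
          (Finset.univ.filter (fun i => f i = 1)).card.factorial *
          (Finset.univ.filter (fun i => f i = 2)).card.factorial) := by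
    funext f
    simp [Fin.prod_univ_four, w]
    ring
  rw [hl] at h
  rw [h]
  congr 1
  have h1 : (∏ j, PowerSeries.mk fun k => w j k / k.factorial) =
      (PowerSeries.mk fun k => s ^ k / k.factorial) * (PowerSeries.mk 1 : PowerSeries ℝ) ^ (2 + 1) := by
    have hq : (PowerSeries.mk fun k => ((k.factorial : ℝ) / k.factorial)) = PowerSeries.mk 1 := by
      congr 1
      funext k
      have : (k.factorial : ℝ) ≠ 0 := by positivity
      simp [this]
    simp [Fin.prod_univ_four, w, hq]
    ring
  rw [h1, PowerSeries.mk_one_pow_eq_mk_choose_add, PowerSeries.coeff_mul,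
    Finset.Nat.sum_antidiagonal_eq_sum_range_succ_mk]
  refine Finset.sum_congr rfl fun k hk => ?_
  have hk' : k ≤ n := by simpa [Nat.lt_succ_iff] using hk
  simp only [PowerSeries.coeff_mk]
  congr 1
  rw [Nat.add_comm, Nat.cast_choose_two]
  push_cast [Nat.cast_sub hk']
  ring

/-- The truncated exponential as a weighted partial sum of the exponential series. -/
lemma sum_eq_truncExpPhi (n : ℕ) (s : ℝ) :
    ∑ k ∈ Finset.range (n + 1),
        s ^ k / k.factorial * (((n : ℝ) - k + 1) * ((n : ℝ) - k + 2) / 2) =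
      ((n : ℝ) + 1) * (n + 2) / 2 * truncExpPhi s n := by
  have h1 : ∀ m : ℕ, ∑ k ∈ Finset.range (m + 1), s ^ k / k.factorial * k =
      s * (∑ k ∈ Finset.range (m + 1), s ^ k / k.factorial - s ^ m / m.factorial) := by
    intro m
    induction m with
    | zero => simp
    | succ m ih =>
      rw [Finset.sum_range_succ, ih, Finset.sum_range_succ _ (m + 1)]
      rw [Nat.factorial_succ]
      push_cast
      field_simp
      ring
  have h2 : ∀ m : ℕ, ∑ k ∈ Finset.range (m + 1), s ^ k / k.factorial * (k * (k - 1)) =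
      s ^ 2 * (∑ k ∈ Finset.range (m + 1), s ^ k / k.factorial) - s ^ (m + 2) / m.factorial
        - m * s ^ (m + 1) / m.factorial := by
    intro m
    induction m with
    | zero => simp
    | succ m ih =>
      rw [Finset.sum_range_succ, ih, Finset.sum_range_succ _ (m + 1)]
      rw [Nat.factorial_succ]
      push_cast
      field_simp
      ring
  -- The quadratic weight is written in the falling factorials `1, k, k(k-1)`, whose exponential
  -- partial sums are the full sum and those in `h1` and `h2`.
  have h3 : ∀ k : ℕ, s ^ k / k.factorial * (((n : ℝ) - k + 1) * ((n : ℝ) - k + 2) / 2) =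
      ((n : ℝ) + 1) * (n + 2) / 2 * (s ^ k / k.factorial)
        - (n + 1) * (s ^ k / k.factorial * k) + s ^ k / k.factorial * (k * (k - 1)) / 2 := by
    intro k; ring
  simp_rw [h3]
  rw [Finset.sum_add_distrib, Finset.sum_sub_distrib, ← Finset.mul_sum, ← Finset.mul_sum,
    ← Finset.sum_div, h1, h2, truncExpPhi, Nat.factorial_succ (n + 1), Nat.factorial_succ n]
  push_cast
  field_simp
  ring

/-! ### Quadruples of permutations compatible with a colouring -/

/-- The three ways of pairing four indices, and (for `3`) equality of all four. -/
def IndexPattern {α : Type*} (j : Fin 4) (a b c d : α) : Prop :=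
  (j = 0 → a = b ∧ c = d) ∧ (j = 1 → a = c ∧ b = d) ∧ (j = 2 → a = d ∧ b = c) ∧
    (j = 3 → a = b ∧ a = c ∧ a = d)

instance {α : Type*} [DecidableEq α] (j : Fin 4) (a b c d : α) :
    Decidable (IndexPattern j a b c d) := by
  unfold IndexPattern; infer_instance

section

variable {α : Type*}

lemma eq_ofSubtype_mul_of_fixes {p q : α → Prop} [DecidablePred p] [DecidablePred q]
    (hpq : ∀ i, p i → ¬ q i) (τ : Equiv.Perm α)
    (hp : ∀ i, p i ↔ p (τ i)) (hq : ∀ i, q i ↔ q (τ i)) (hfix : ∀ i, ¬ p i → ¬ q i → τ i = i) :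
    τ = Equiv.Perm.ofSubtype (τ.subtypePerm (fun i => (hp i).symm)) *
      Equiv.Perm.ofSubtype (τ.subtypePerm (fun i => (hq i).symm)) := by
  ext i
  rw [Equiv.Perm.mul_apply]
  by_cases h2 : q i
  · rw [Equiv.Perm.ofSubtype_apply_of_mem _ h2, Equiv.Perm.subtypePerm_apply,
      Equiv.Perm.ofSubtype_apply_of_not_mem]
    exact fun h => hpq _ h ((hq i).1 h2)
  · rw [Equiv.Perm.ofSubtype_apply_of_not_mem _ h2]
    by_cases h1 : p i
    · rw [Equiv.Perm.ofSubtype_apply_of_mem _ h1, Equiv.Perm.subtypePerm_apply]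
    · rw [Equiv.Perm.ofSubtype_apply_of_not_mem _ h1, hfix i h1 h2]

lemma ofSubtype_mul_apply_left {p q : α → Prop} [DecidablePred p] [DecidablePred q]
    (g : Equiv.Perm {i // p i}) (h : Equiv.Perm {i // q i}) (hpq : ∀ i, p i → ¬ q i)
    {i : α} (hi : p i) :
    (Equiv.Perm.ofSubtype g * Equiv.Perm.ofSubtype h) i = g ⟨i, hi⟩ := by
  rw [Equiv.Perm.mul_apply, Equiv.Perm.ofSubtype_apply_of_not_mem _ (hpq i hi),
    Equiv.Perm.ofSubtype_apply_of_mem _ hi]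

lemma ofSubtype_mul_apply_right {p q : α → Prop} [DecidablePred p] [DecidablePred q]
    (g : Equiv.Perm {i // p i}) (h : Equiv.Perm {i // q i}) (hpq : ∀ i, p i → ¬ q i)
    {i : α} (hi : q i) :
    (Equiv.Perm.ofSubtype g * Equiv.Perm.ofSubtype h) i = h ⟨i, hi⟩ := by
  rw [Equiv.Perm.mul_apply, Equiv.Perm.ofSubtype_apply_of_mem _ hi,
    Equiv.Perm.ofSubtype_apply_of_not_mem]
  exact fun h' => hpq _ h' (h ⟨i, hi⟩).2

lemma ofSubtype_mul_apply_neither {p q : α → Prop} [DecidablePred p] [DecidablePred q]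
    (g : Equiv.Perm {i // p i}) (h : Equiv.Perm {i // q i})
    {i : α} (hi : ¬ p i) (hi' : ¬ q i) :
    (Equiv.Perm.ofSubtype g * Equiv.Perm.ofSubtype h) i = i := by
  rw [Equiv.Perm.mul_apply, Equiv.Perm.ofSubtype_apply_of_not_mem _ hi',
    Equiv.Perm.ofSubtype_apply_of_not_mem _ hi]

/-- The quadruple of permutations assembled from a common factor and a permutation of each of
the first three colour classes of `f`. -/
def patternQuadruple (f : α → Fin 4)
    (y : Equiv.Perm α × Equiv.Perm {i // f i = 0} × Equiv.Perm {i // f i = 1} ×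
      Equiv.Perm {i // f i = 2}) :
    Equiv.Perm α × Equiv.Perm α × Equiv.Perm α × Equiv.Perm α :=
  (y.1, y.1 * (Equiv.Perm.ofSubtype y.2.2.1 * Equiv.Perm.ofSubtype y.2.2.2),
    y.1 * (Equiv.Perm.ofSubtype y.2.1 * Equiv.Perm.ofSubtype y.2.2.2),
    y.1 * (Equiv.Perm.ofSubtype y.2.1 * Equiv.Perm.ofSubtype y.2.2.1))

lemma patternQuadruple_injective (f : α → Fin 4) : Function.Injective (patternQuadruple f) := by
  rintro ⟨ρ, a, b, c⟩ ⟨ρ', a', b', c'⟩ h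
  simp only [patternQuadruple, Prod.mk.injEq] at h
  obtain ⟨rfl, h2, h3, h4⟩ := h
  have h2 := mul_left_cancel h2
  have h3 := mul_left_cancel h3
  have ha : a = a' := by
    ext ⟨i, hi⟩
    have := congrArg (fun τ => τ i) h3
    rwa [ofSubtype_mul_apply_left (p := fun i => f i = 0) (q := fun i => f i = 2) _ _ (fun i h h' => absurd (h.symm.trans h') (by decide)) hi,
      ofSubtype_mul_apply_left (p := fun i => f i = 0) (q := fun i => f i = 2) _ _ (fun i h h' => absurd (h.symm.trans h') (by decide)) hi] at this
  have hb : b = b' := by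
    ext ⟨i, hi⟩
    have := congrArg (fun τ => τ i) h2
    rwa [ofSubtype_mul_apply_left (p := fun i => f i = 1) (q := fun i => f i = 2) _ _ (fun i h h' => absurd (h.symm.trans h') (by decide)) hi,
      ofSubtype_mul_apply_left (p := fun i => f i = 1) (q := fun i => f i = 2) _ _ (fun i h h' => absurd (h.symm.trans h') (by decide)) hi] at this
  have hc : c = c' := by
    ext ⟨i, hi⟩
    have := congrArg (fun τ => τ i) h3
    rwa [ofSubtype_mul_apply_right (p := fun i => f i = 0) (q := fun i => f i = 2) _ _ (fun i h h' => absurd (h.symm.trans h') (by decide)) hi,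
      ofSubtype_mul_apply_right (p := fun i => f i = 0) (q := fun i => f i = 2) _ _ (fun i h h' => absurd (h.symm.trans h') (by decide)) hi] at this
  rw [ha, hb, hc]

lemma indexPattern_patternQuadruple (f : α → Fin 4) (y) (i : α) :
    IndexPattern (f i) ((patternQuadruple f y).1 i) ((patternQuadruple f y).2.1 i)
      ((patternQuadruple f y).2.2.1 i) ((patternQuadruple f y).2.2.2 i) := by
  obtain ⟨ρ, a, b, c⟩ := y
  simp only [patternQuadruple, Equiv.Perm.mul_apply ρ, IndexPattern,
    EmbeddingLike.apply_eq_iff_eq]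
  refine ⟨fun h => ⟨?_, ?_⟩, fun h => ⟨?_, ?_⟩, fun h => ⟨?_, ?_⟩, fun h => ⟨?_, ?_, ?_⟩⟩
  · rw [ofSubtype_mul_apply_neither] <;> simp [h]
  · rw [ofSubtype_mul_apply_left (p := fun i => f i = 0) (q := fun i => f i = 2) _ _ (fun i h h' => absurd (h.symm.trans h') (by decide)) h,
      ofSubtype_mul_apply_left (p := fun i => f i = 0) (q := fun i => f i = 1) _ _ (fun i h h' => absurd (h.symm.trans h') (by decide)) h]
  · rw [ofSubtype_mul_apply_neither] <;> simp [h]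
  · rw [ofSubtype_mul_apply_left (p := fun i => f i = 1) (q := fun i => f i = 2) _ _ (fun i h h' => absurd (h.symm.trans h') (by decide)) h,
      ofSubtype_mul_apply_right (p := fun i => f i = 0) (q := fun i => f i = 1) _ _ (fun i h h' => absurd (h.symm.trans h') (by decide)) h]
  · rw [ofSubtype_mul_apply_neither] <;> simp [h]
  · rw [ofSubtype_mul_apply_right (p := fun i => f i = 1) (q := fun i => f i = 2) _ _ (fun i h h' => absurd (h.symm.trans h') (by decide)) h,
      ofSubtype_mul_apply_right (p := fun i => f i = 0) (q := fun i => f i = 2) _ _ (fun i h h' => absurd (h.symm.trans h') (by decide)) h]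
  all_goals rw [ofSubtype_mul_apply_neither] <;> simp [h]

/-- After dividing by the first permutation `ρ`, each quotient fixes one pairing class and colour 3
pointwise, and on each pairing class the other two quotients agree. Injectivity then forces them to
preserve that class, so they are assembled from one permutation per class. -/
lemma mem_range_patternQuadruple (f : α → Fin 4)
    (σ : Equiv.Perm α × Equiv.Perm α × Equiv.Perm α × Equiv.Perm α)
    (hσ : ∀ i, IndexPattern (f i) (σ.1 i) (σ.2.1 i) (σ.2.2.1 i) (σ.2.2.2 i)) :
    σ ∈ Set.range (patternQuadruple f) := by
  obtain ⟨ρ, σ2, σ3, σ4⟩ := σ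
  obtain ⟨τ2, rfl⟩ : ∃ τ, σ2 = ρ * τ := ⟨ρ⁻¹ * σ2, by simp⟩
  obtain ⟨τ3, rfl⟩ : ∃ τ, σ3 = ρ * τ := ⟨ρ⁻¹ * σ3, by simp⟩
  obtain ⟨τ4, rfl⟩ : ∃ τ, σ4 = ρ * τ := ⟨ρ⁻¹ * σ4, by simp⟩
  simp only [Equiv.Perm.mul_apply ρ, IndexPattern, EmbeddingLike.apply_eq_iff_eq] at hσ
  have e2 := τ2.injective
  have e3 := τ3.injective
  have e4 := τ4.injective
  have h0 : ∀ i, f i = 0 → i = τ2 i ∧ τ3 i = τ4 i := fun i => (hσ i).1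
  have h1 : ∀ i, f i = 1 → i = τ3 i ∧ τ2 i = τ4 i := fun i => (hσ i).2.1
  have h2 : ∀ i, f i = 2 → i = τ4 i ∧ τ2 i = τ3 i := fun i => (hσ i).2.2.1
  have h3 : ∀ i, f i = 3 → i = τ2 i ∧ i = τ3 i ∧ i = τ4 i := fun i => (hσ i).2.2.2
  have hc : ∀ i, f i = 0 ∨ f i = 1 ∨ f i = 2 ∨ f i = 3 := fun i => by
    generalize f i = j; revert j; decide
  -- A class cannot leak into another: on class 0, `τ3` and `τ4` agree, while any point of another
  -- class is fixed by one of them, so mapping into it would contradict injectivity. The converse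
  -- and the five claims below are similar.
  have k30 : ∀ i, f i = 0 ↔ f (τ3 i) = 0 := by
    intro i
    have := hc i
    have := hc (τ3 i)
    have := @e2 i (τ3 i)
    have := @e3 i (τ3 i)
    have := @e4 i (τ3 i)
    grind
  have k40 : ∀ i, f i = 0 ↔ f (τ4 i) = 0 := by
    intro i
    have := hc i
    have := hc (τ4 i)
    have := @e2 i (τ4 i)
    have := @e3 i (τ4 i)
    have := @e4 i (τ4 i)
    grind
  have k21 : ∀ i, f i = 1 ↔ f (τ2 i) = 1 := by
    intro i
    have := hc i
    have := hc (τ2 i)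
    have := @e2 i (τ2 i)
    have := @e3 i (τ2 i)
    have := @e4 i (τ2 i)
    grind
  have k41 : ∀ i, f i = 1 ↔ f (τ4 i) = 1 := by
    intro i
    have := hc i
    have := hc (τ4 i)
    have := @e2 i (τ4 i)
    have := @e3 i (τ4 i)
    have := @e4 i (τ4 i)
    grind
  have k22 : ∀ i, f i = 2 ↔ f (τ2 i) = 2 := by
    intro i
    have := hc i
    have := hc (τ2 i)
    have := @e2 i (τ2 i)
    have := @e3 i (τ2 i)
    have := @e4 i (τ2 i)
    grind
  have k32 : ∀ i, f i = 2 ↔ f (τ3 i) = 2 := by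
    intro i
    have := hc i
    have := hc (τ3 i)
    have := @e2 i (τ3 i)
    have := @e3 i (τ3 i)
    have := @e4 i (τ3 i)
    grind
  have hdisj : ∀ {j k : Fin 4}, j ≠ k → ∀ i, f i = j → ¬ f i = k :=
    fun hjk i h h' => hjk (h.symm.trans h')
  refine ⟨(ρ, τ3.subtypePerm (fun i => (k30 i).symm), τ2.subtypePerm (fun i => (k21 i).symm),
    τ2.subtypePerm (fun i => (k22 i).symm)), ?_⟩
  have s34 : τ3.subtypePerm (p := fun i => f i = 0) (fun i => (k30 i).symm) = τ4.subtypePerm (p := fun i => f i = 0) (fun i => (k40 i).symm) := by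
    ext ⟨i, hi⟩
    exact (h0 i hi).2
  have s24 : τ2.subtypePerm (p := fun i => f i = 1) (fun i => (k21 i).symm) = τ4.subtypePerm (p := fun i => f i = 1) (fun i => (k41 i).symm) := by
    ext ⟨i, hi⟩
    exact (h1 i hi).2
  have s23 : τ2.subtypePerm (p := fun i => f i = 2) (fun i => (k22 i).symm) = τ3.subtypePerm (p := fun i => f i = 2) (fun i => (k32 i).symm) := by
    ext ⟨i, hi⟩
    exact (h2 i hi).2
  have t2 := eq_ofSubtype_mul_of_fixes (p := fun i => f i = 1) (q := fun i => f i = 2)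
    (hdisj (by decide)) τ2 k21 k22 (fun i _ _ => by
    have := hc i; grind)
  have t3 := eq_ofSubtype_mul_of_fixes (p := fun i => f i = 0) (q := fun i => f i = 2)
    (hdisj (by decide)) τ3 k30 k32 (fun i _ _ => by
    have := hc i; grind)
  have t4 := eq_ofSubtype_mul_of_fixes (p := fun i => f i = 0) (q := fun i => f i = 1)
    (hdisj (by decide)) τ4 k40 k41 (fun i _ _ => by
    have := hc i; grind)
  simp only [patternQuadruple]
  rw [← t2]
  rw [s23, ← t3, s34, s24, ← t4]

variable [Fintype α] [DecidableEq α]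

/-- The product of the signs of four permutations. -/
def signProd (σ : Equiv.Perm α × Equiv.Perm α × Equiv.Perm α × Equiv.Perm α) : ℝ :=
  ((Equiv.Perm.sign σ.1 * Equiv.Perm.sign σ.2.1 * Equiv.Perm.sign σ.2.2.1 *
    Equiv.Perm.sign σ.2.2.2 : ℤˣ) : ℤ)

/-- The sign of `ρ` occurs four times and that of each class permutation twice. -/
lemma signProd_patternQuadruple (f : α → Fin 4) (y) : signProd (patternQuadruple f y) = 1 := by
  obtain ⟨ρ, a, b, c⟩ := y
  simp only [patternQuadruple, signProd, Equiv.Perm.sign_mul, Equiv.Perm.sign_ofSubtype]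
  rcases Int.units_eq_one_or (Equiv.Perm.sign ρ) with h | h <;>
  rcases Int.units_eq_one_or (Equiv.Perm.sign a) with h1 | h1 <;>
  rcases Int.units_eq_one_or (Equiv.Perm.sign b) with h2 | h2 <;>
  rcases Int.units_eq_one_or (Equiv.Perm.sign c) with h3 | h3 <;>
  simp [h, h1, h2, h3]

/-- The product of indicators vanishes off the range of `patternQuadruple f`, and on the range every
term is `1`, so the sum counts the parameters. -/
lemma sum_signProd_indexPattern (f : α → Fin 4) :
    ∑ σ : Equiv.Perm α × Equiv.Perm α × Equiv.Perm α × Equiv.Perm α,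
      signProd σ * ∏ i, (if IndexPattern (f i) (σ.1 i) (σ.2.1 i) (σ.2.2.1 i) (σ.2.2.2 i)
        then (1 : ℝ) else 0) =
    (Fintype.card α).factorial * ((Finset.univ.filter (fun i => f i = 0)).card.factorial *
          (Finset.univ.filter (fun i => f i = 1)).card.factorial *
          (Finset.univ.filter (fun i => f i = 2)).card.factorial) := by
  rw [← Fintype.sum_of_injective (patternQuadruple f) (patternQuadruple_injective f) (fun _ => 1)]
  · simp only [Finset.sum_const, Finset.card_univ, Fintype.card_prod, Fintype.card_perm,
      Fintype.card_subtype, nsmul_eq_mul, mul_one]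
    push_cast
    ring
  · intro σ hσ
    obtain ⟨i, hi⟩ : ∃ i, ¬ IndexPattern (f i) (σ.1 i) (σ.2.1 i) (σ.2.2.1 i) (σ.2.2.2 i) := by
      by_contra! h
      exact hσ (mem_range_patternQuadruple f σ h)
    rw [Finset.prod_eq_zero (Finset.mem_univ i) (by simp [hi]), mul_zero]
  · intro y
    simp [signProd_patternQuadruple, indexPattern_patternQuadruple]

end

/-- The signed sum over quadruples of permutations of a product of tensors that mix the three
pairings with the total diagonal. -/
lemma sum_signProd_prod_pattern (n : ℕ) (s : ℝ) :
    ∑ σ : Equiv.Perm (Fin n) × Equiv.Perm (Fin n) × Equiv.Perm (Fin n) × Equiv.Perm (Fin n),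
      signProd σ * ∏ i, ∑ j : Fin 4, (if j = 3 then s else 1) *
        (if IndexPattern j (σ.1 i) (σ.2.1 i) (σ.2.2.1 i) (σ.2.2.2 i) then (1 : ℝ) else 0) =
    (n.factorial : ℝ) ^ 2 * (((n : ℝ) + 1) * (n + 2) / 2 * truncExpPhi s n) := by
  have h : ∀ σ : Equiv.Perm (Fin n) × Equiv.Perm (Fin n) × Equiv.Perm (Fin n) × Equiv.Perm (Fin n),
      ∏ i, ∑ j : Fin 4, (if j = 3 then s else 1) *
        (if IndexPattern j (σ.1 i) (σ.2.1 i) (σ.2.2.1 i) (σ.2.2.2 i) then (1 : ℝ) else 0) =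
      ∑ f : Fin n → Fin 4, s ^ (Finset.univ.filter (fun i => f i = 3)).card *
        ∏ i, (if IndexPattern (f i) (σ.1 i) (σ.2.1 i) (σ.2.2.1 i) (σ.2.2.2 i)
          then (1 : ℝ) else 0) := by
    intro σ
    rw [Finset.prod_univ_sum, Fintype.piFinset_univ]
    refine Finset.sum_congr rfl fun f _ => ?_
    rw [Finset.prod_mul_distrib]
    simp [Finset.prod_ite]
  simp_rw [h, Finset.mul_sum]
  rw [Finset.sum_comm]
  have h' : ∀ f : Fin n → Fin 4, ∑ σ : Equiv.Perm (Fin n) × Equiv.Perm (Fin n) ×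
      Equiv.Perm (Fin n) × Equiv.Perm (Fin n),
      signProd σ * (s ^ (Finset.univ.filter (fun i => f i = 3)).card *
        ∏ i, (if IndexPattern (f i) (σ.1 i) (σ.2.1 i) (σ.2.2.1 i) (σ.2.2.2 i)
          then (1 : ℝ) else 0)) =
      n.factorial * (s ^ (Finset.univ.filter (fun i => f i = 3)).card *
        ((Finset.univ.filter (fun i => f i = 0)).card.factorial *
          (Finset.univ.filter (fun i => f i = 1)).card.factorial *
          (Finset.univ.filter (fun i => f i = 2)).card.factorial)) := by
    intro f
    simp_rw [mul_left_comm (signProd _)]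
    rw [← Finset.mul_sum, sum_signProd_indexPattern, Fintype.card_fin]
    ring
  simp_rw [h']
  rw [← Finset.mul_sum, sum_fourColouring, sum_eq_truncExpPhi]
  ring

/-! ### Volume of the symmetric polytope -/

/-- The convex hull of `± x₁, …, ± x_n` as a linear image of the `ℓ¹` unit ball. -/
lemma convexHull_range_union_range_neg {ι E : Type*} [Fintype ι] [Nonempty ι] [AddCommGroup E]
    [Module ℝ E] (x : ι → E) :
    convexHull ℝ (Set.range x ∪ Set.range (fun i => -x i)) =
      (fun c : ι → ℝ => ∑ i, c i • x i) '' {c | ∑ i, |c i| ≤ 1} := by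
  classical
  apply Set.Subset.antisymm
  · have hconv : Convex ℝ {c : ι → ℝ | ∑ i, |c i| ≤ 1} := by
      intro c hc d hd a b ha hb hab
      simp only [Set.mem_ofPred_eq] at hc hd ⊢
      calc ∑ i, |(a • c + b • d) i| ≤ ∑ i, (a * |c i| + b * |d i|) := by
            refine Finset.sum_le_sum fun i _ => ?_
            calc _ ≤ |a * c i| + |b * d i| := abs_add_le _ _
              _ = _ := by rw [abs_mul, abs_mul, abs_of_nonneg ha, abs_of_nonneg hb]
        _ = a * ∑ i, |c i| + b * ∑ i, |d i| := by
            rw [Finset.sum_add_distrib, Finset.mul_sum, Finset.mul_sum]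
        _ ≤ a * 1 + b * 1 := by gcongr
        _ = 1 := by simpa using hab
    refine convexHull_min ?_ ?_
    · rintro _ (⟨i, rfl⟩ | ⟨i, rfl⟩)
      · refine ⟨Pi.single i 1, ?_, ?_⟩
        · simp [Pi.single_apply, apply_ite]
        · simp [Pi.single_apply]
      · refine ⟨Pi.single i (-1), ?_, ?_⟩
        · simp [Pi.single_apply, apply_ite]
        · simp [Pi.single_apply]
    · exact hconv.linear_image (Fintype.linearCombination ℝ x)
  · rintro _ ⟨c, hc, rfl⟩
    have hC := convex_convexHull ℝ (Set.range x ∪ Set.range (fun i => -x i))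
    have hpos : ∀ i, x i ∈ convexHull ℝ (Set.range x ∪ Set.range (fun i => -x i)) :=
      fun i => subset_convexHull _ _ (Or.inl ⟨i, rfl⟩)
    have hneg : ∀ i, -x i ∈ convexHull ℝ (Set.range x ∪ Set.range (fun i => -x i)) :=
      fun i => subset_convexHull _ _ (Or.inr ⟨i, rfl⟩)
    have h0 : (0 : E) ∈ convexHull ℝ (Set.range x ∪ Set.range (fun i => -x i)) := by
      obtain ⟨i⟩ := ‹Nonempty ι›
      have := hC (hpos i) (hneg i) (a := 1 / 2) (b := 1 / 2) (by norm_num) (by norm_num)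
        (by norm_num)
      simpa using this
    -- The slack `1 - ∑ |c i|` is put on the origin, and the sign of `c i` decides between `x i` and
    -- `-x i`.
    have := hC.sum_mem (t := Finset.univ)
      (w := fun o : Option ι => o.elim (1 - ∑ i, |c i|) fun i => |c i|)
      (z := fun o : Option ι => o.elim 0 fun i => if 0 ≤ c i then x i else -x i) ?_ ?_ ?_
    · rw [Fintype.sum_option] at this
      simp only [Option.elim, smul_zero, zero_add] at this
      convert this using 2 with i
      split_ifs with h
      · rw [abs_of_nonneg h]
      · rw [abs_of_neg (not_le.1 h), smul_neg, neg_smul, neg_neg]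
    · rintro (_ | i) _
      · simpa using hc
      · simp
    · rw [Fintype.sum_option]
      simp
    · rintro (_ | i) _
      · exact h0
      · simp only [Option.elim]
        split_ifs
        · exact hpos i
        · exact hneg i

lemma volume_real_sum_abs_le_one (n : ℕ) [NeZero n] :
    volume.real {c : Fin n → ℝ | ∑ i, |c i| ≤ 1} = 2 ^ n / n.factorial := by
  have h := MeasureTheory.volume_sum_rpow_le (ι := Fin n) (p := 1) le_rfl 1
  simp only [Real.rpow_one, div_one, Fintype.card_fin, ENNReal.ofReal_one, one_pow, one_mul,
    Real.Gamma_nat_eq_factorial] at h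
  have h2 : Real.Gamma (1 + 1) = 1 := by
    simpa using Real.Gamma_nat_eq_factorial 1
  rw [h2, mul_one] at h
  rw [Measure.real, h, ENNReal.toReal_ofReal (by positivity)]

/-- The volume of the convex hull of `± x₁, …, ± x_n` in `ℝⁿ`. -/
lemma volume_real_convexHull_range_union_range_neg {n : ℕ} [NeZero n]
    (x : Fin n → EuclideanSpace ℝ (Fin n)) :
    volume.real (convexHull ℝ (Set.range x ∪ Set.range (fun i => -x i))) =
      2 ^ n / n.factorial * |(Matrix.of fun i j => x i j).det| := by
  have hset : convexHull ℝ (Set.range x ∪ Set.range (fun i => -x i)) =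
      (MeasurableEquiv.toLp 2 (Fin n → ℝ)).symm ⁻¹'
        (Matrix.toLin' (Matrix.of fun i j => x i j).transpose '' {c | ∑ i, |c i| ≤ 1}) := by
    rw [convexHull_range_union_range_neg]
    ext y
    simp only [Set.mem_image, Set.mem_preimage]
    refine exists_congr fun c => and_congr_right fun _ => ?_
    rw [← (MeasurableEquiv.toLp 2 (Fin n → ℝ)).symm.injective.eq_iff]
    refine Eq.congr ?_ rfl
    ext j
    simp [Matrix.mulVec, dotProduct, mul_comm]
  rw [hset, Measure.real, (EuclideanSpace.volume_preserving_symm_measurableEquiv_toLp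
    (Fin n)).measure_preimage_equiv, Measure.addHaar_image_linearMap, ENNReal.toReal_mul,
    LinearMap.det_toLin', Matrix.det_transpose, ENNReal.toReal_ofReal (abs_nonneg _), mul_comm]
  congr 1
  exact volume_real_sum_abs_le_one n

/-! ### Moments of a 1-symmetric body -/

lemma setIntegral_comp_linearIsometryEquiv {n : ℕ} {K : Set (EuclideanSpace ℝ (Fin n))}
    (e : EuclideanSpace ℝ (Fin n) ≃ₗᵢ[ℝ] EuclideanSpace ℝ (Fin n)) (he : e '' K = K)
    (g : EuclideanSpace ℝ (Fin n) → ℝ) : ∫ x in K, g (e x) = ∫ x in K, g x := by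
  have h := e.measurePreserving.setIntegral_preimage_emb
    e.toHomeomorph.measurableEmbedding g K
  have hpre : e ⁻¹' K = K := by
    conv_lhs => rw [← he]
    exact e.injective.preimage_image K
  rwa [hpre] at h

lemma IsOneSymmetric.setIntegral_reflect {n : ℕ} {K : Set (EuclideanSpace ℝ (Fin n))}
    (hK : IsOneSymmetric K) (i : Fin n) (g : EuclideanSpace ℝ (Fin n) → ℝ) :
    ∫ x in K, g (coordReflect i x) = ∫ x in K, g x := by
  let e : EuclideanSpace ℝ (Fin n) ≃ₗᵢ[ℝ] EuclideanSpace ℝ (Fin n) :=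
    LinearIsometryEquiv.piLpCongrRight 2
      (fun j => if j = i then LinearIsometryEquiv.neg ℝ else LinearIsometryEquiv.refl ℝ ℝ)
  have he : ⇑e = coordReflect i := by
    funext x
    ext j
    by_cases h : j = i <;> simp [e, coordReflect, h]
  have := setIntegral_comp_linearIsometryEquiv e (by rw [he]; exact hK.reflect_eq i) g
  rwa [he] at this

lemma IsOneSymmetric.setIntegral_permute {n : ℕ} {K : Set (EuclideanSpace ℝ (Fin n))}
    (hK : IsOneSymmetric K) (σ : Equiv.Perm (Fin n)) (g : EuclideanSpace ℝ (Fin n) → ℝ) :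
    ∫ x in K, g (coordPermute σ x) = ∫ x in K, g x := by
  let e : EuclideanSpace ℝ (Fin n) ≃ₗᵢ[ℝ] EuclideanSpace ℝ (Fin n) :=
    LinearIsometryEquiv.piLpCongrLeft 2 ℝ ℝ σ.symm
  have he : ⇑e = coordPermute σ := by
    funext x
    ext j
    simp [e, coordPermute, Equiv.piCongrLeft']
  have := setIntegral_comp_linearIsometryEquiv e (by rw [he]; exact hK.permute_eq σ) g
  rwa [he] at this

/-- If `i` occurs an odd number of times among the four indices, reflecting coordinate `i` changes
the sign of the integrand but not the integral. -/
lemma IsOneSymmetric.moment_eq_zero {n : ℕ} {K : Set (EuclideanSpace ℝ (Fin n))}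
    (hK : IsOneSymmetric K) (i a b c d : Fin n)
    (h : (if a = i then (-1 : ℝ) else 1) * (if b = i then -1 else 1) * (if c = i then -1 else 1) *
      (if d = i then -1 else 1) = -1) :
    ∫ x in K, x a * x b * x c * x d = 0 := by
  have h1 := hK.setIntegral_reflect i (fun x => x a * x b * x c * x d)
  have h2 : ∀ x : EuclideanSpace ℝ (Fin n), coordReflect i x a * coordReflect i x b *
      coordReflect i x c * coordReflect i x d = -(x a * x b * x c * x d) := by
    intro x
    have h3 : ∀ a, coordReflect i x a = (if a = i then (-1 : ℝ) else 1) * x a := by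
      intro a
      by_cases ha : a = i <;> simp [coordReflect, ha]
    rw [h3, h3, h3, h3]
    linear_combination (x a * x b * x c * x d) * h
  simp_rw [h2] at h1
  rw [integral_neg] at h1
  linarith

lemma IsOneSymmetric.setIntegral_pow_four {n : ℕ} {K : Set (EuclideanSpace ℝ (Fin n))}
    (hK : IsOneSymmetric K) (a b : Fin n) : ∫ x in K, x a ^ 4 = ∫ x in K, x b ^ 4 := by
  rw [← hK.setIntegral_permute (Equiv.swap a b) (fun x => x a ^ 4)]
  simp [coordPermute]

lemma IsOneSymmetric.setIntegral_sq_mul_sq {n : ℕ} {K : Set (EuclideanSpace ℝ (Fin n))}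
    (hK : IsOneSymmetric K) {a b c d : Fin n} (hab : a ≠ b) (hcd : c ≠ d) :
    ∫ x in K, x a ^ 2 * x b ^ 2 = ∫ x in K, x c ^ 2 * x d ^ 2 := by
  obtain ⟨σ, hσ⟩ : ∃ σ : Equiv.Perm (Fin n), σ a = c ∧ σ b = d := by
    -- The first swap sends `a` to `c`; the second corrects the image of `b` to `d` without moving
    -- `c`.
    refine ⟨Equiv.swap (Equiv.swap a c b) d * Equiv.swap a c, ?_, ?_⟩
    · rw [Equiv.Perm.mul_apply, Equiv.swap_apply_left, Equiv.swap_apply_of_ne_of_ne _ hcd]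
      intro h
      exact hab ((Equiv.swap a c).injective (by rw [← h, Equiv.swap_apply_left]))
    · rw [Equiv.Perm.mul_apply, Equiv.swap_apply_left]
  rw [← hK.setIntegral_permute σ (fun x => x a ^ 2 * x b ^ 2)]
  simp [coordPermute, hσ.1, hσ.2]

/-- Fourth moments of a 1-symmetric body. -/
lemma IsOneSymmetric.moment_four {n : ℕ} (hn : 2 ≤ n) {K : Set (EuclideanSpace ℝ (Fin n))}
    (hK : IsOneSymmetric K) (hpos : mixedMoment hn K ≠ 0) (a b c d : Fin n) :
    ∫ x in K, x a * x b * x c * x d = mixedMoment hn K * ∑ j : Fin 4,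
      (if j = 3 then momentRatio hn K - 3 else 1) *
        (if IndexPattern j a b c d then (1 : ℝ) else 0) := by
  have hmix : ∀ a b : Fin n, a ≠ b → ∫ x in K, x a ^ 2 * x b ^ 2 = mixedMoment hn K :=
    fun a b hab => hK.setIntegral_sq_mul_sq hab (by simp)
  have hfour : ∀ a : Fin n, ∫ x in K, x a ^ 4 = mixedMoment hn K * momentRatio hn K := by
    intro a
    rw [momentRatio, mul_div_cancel₀ _ hpos]
    exact hK.setIntegral_pow_four _ _
  have hodd : ∀ a b c d : Fin n, ∀ i, (if a = i then (-1 : ℝ) else 1) *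
      (if b = i then -1 else 1) * (if c = i then -1 else 1) * (if d = i then -1 else 1) = -1 →
      ∫ x in K, x a * x b * x c * x d = 0 := fun a b c d i => hK.moment_eq_zero i a b c d
  have hsum : ∀ u v : ℝ, ∑ j : Fin 4, (if j = 3 then u else 1) *
        (if IndexPattern j a b c d then v else 0) =
      (if a = b ∧ c = d then v else 0) + (if a = c ∧ b = d then v else 0) +
        (if a = d ∧ b = c then v else 0) +
          u * (if a = b ∧ a = c ∧ a = d then v else 0) := by
    intro u v
    simp [Fin.sum_univ_four, IndexPattern]
  rw [hsum]
  by_cases hab : a = b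
  · subst hab
    by_cases hcd : c = d
    · subst hcd
      by_cases hac : a = c
      · subst hac
        simp only [and_self, if_true]
        rw [show mixedMoment hn K * (1 + 1 + 1 + (momentRatio hn K - 3) * 1) =
          mixedMoment hn K * momentRatio hn K by ring, ← hfour a]
        congr with x
        ring
      · simp only [hac, and_self, if_true, if_false, and_false]
        rw [show mixedMoment hn K * (1 + 0 + 0 + (momentRatio hn K - 3) * 0) =
          mixedMoment hn K by ring, ← hmix a c hac]
        congr with x
        ring
    · have : ∫ x in K, x a * x a * x c * x d = 0 := by
        apply hodd a a c d c
        have : d ≠ c := Ne.symm hcd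
        split_ifs <;> simp_all
      rw [this]
      grind
  · by_cases hac : a = c
    · subst hac
      by_cases hbd : b = d
      · subst hbd
        have hba := Ne.symm hab
        simp only [hab, hba, and_self, if_true, if_false, false_and]
        rw [show mixedMoment hn K * (0 + 1 + 0 + (momentRatio hn K - 3) * 0) =
          mixedMoment hn K by ring, ← hmix a b hab]
        congr with x
        ring
      · have : ∫ x in K, x a * x b * x a * x d = 0 := by
          apply hodd a b a d b
          have : d ≠ b := Ne.symm hbd
          split_ifs <;> simp_all
        rw [this]
        grind
    · by_cases had : a = d
      · subst had
        by_cases hbc : b = c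
        · subst hbc
          have hba := Ne.symm hab
          simp only [hab, hba, and_self, if_true, if_false, and_true]
          rw [show mixedMoment hn K * (0 + 0 + 1 + (momentRatio hn K - 3) * 0) =
            mixedMoment hn K by ring, ← hmix a b hab]
          congr with x
          ring
        · have : ∫ x in K, x a * x b * x c * x a = 0 := by
            apply hodd a b c a b
            have : c ≠ b := Ne.symm hbc
            split_ifs <;> simp_all
          rw [this]
          grind
      · have : ∫ x in K, x a * x b * x c * x d = 0 := by
          apply hodd a b c d a
          simp [Ne.symm hab, Ne.symm hac, Ne.symm had]
        rw [this]
        grind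

lemma IsSymmConvexBody.integrableOn_of_continuous {n : ℕ} {K : Set (EuclideanSpace ℝ (Fin n))}
    (hK : IsSymmConvexBody K) {g : EuclideanSpace ℝ (Fin n) → ℝ} (hg : Continuous g) :
    IntegrableOn g K :=
  hg.continuousOn.integrableOn_compact hK.isCompact

lemma volume_coord_eq_zero {n : ℕ} (i : Fin n) :
    volume {x : EuclideanSpace ℝ (Fin n) | x i = 0} = 0 := by
  have h := Measure.addHaar_submodule (volume : Measure (EuclideanSpace ℝ (Fin n)))
    (LinearMap.ker (EuclideanSpace.proj i : EuclideanSpace ℝ (Fin n) →L[ℝ] ℝ).toLinearMap) ?_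
  · convert h using 2
    ext x
    simp
  · intro h
    have : EuclideanSpace.single i (1 : ℝ) ∈ LinearMap.ker
      (EuclideanSpace.proj i : EuclideanSpace ℝ (Fin n) →L[ℝ] ℝ).toLinearMap := by
      rw [h]; trivial
    simp at this

lemma IsSymmConvexBody.volume_pos {n : ℕ} {K : Set (EuclideanSpace ℝ (Fin n))}
    (hK : IsSymmConvexBody K) : 0 < volume K :=
  (isOpen_interior.measure_pos _ hK.interior_nonempty).trans_le (measure_mono interior_subset)

/-- The integrand is positive off two coordinate hyperplanes, which are null, while `K` has positive
volume. -/
lemma IsSymmConvexBody.mixedMoment_pos {n : ℕ} (hn : 2 ≤ n) {K : Set (EuclideanSpace ℝ (Fin n))}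
    (hK : IsSymmConvexBody K) : 0 < mixedMoment hn K := by
  rw [mixedMoment, setIntegral_pos_iff_support_of_nonneg_ae
    (Filter.Eventually.of_forall fun x => by positivity)
    (hK.integrableOn_of_continuous (by fun_prop))]
  have hnull : volume ({x : EuclideanSpace ℝ (Fin n) | x ⟨0, by omega⟩ = 0} ∪
      {x : EuclideanSpace ℝ (Fin n) | x ⟨1, by omega⟩ = 0}) = 0 :=
    measure_union_null (volume_coord_eq_zero _) (volume_coord_eq_zero _)
  refine (hK.volume_pos.trans_eq (measure_sdiff_null hnull).symm).trans_le (measure_mono ?_)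
  rintro x ⟨hx, hx'⟩
  simp only [Set.mem_union, Set.mem_ofPred_eq, not_or] at hx'
  exact ⟨by simp [hx'.1, hx'.2], hx⟩

/-! ### Fourth moment of the random determinant -/

lemma Matrix.det_pow_four_eq_sum {n : ℕ} (M : Matrix (Fin n) (Fin n) ℝ) :
    M.det ^ 4 = ∑ σ : Equiv.Perm (Fin n) × Equiv.Perm (Fin n) × Equiv.Perm (Fin n) ×
      Equiv.Perm (Fin n), signProd σ *
        ∏ i, (M i (σ.1 i) * M i (σ.2.1 i) * M i (σ.2.2.1 i) * M i (σ.2.2.2 i)) := by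
  have h : M.det = ∑ σ : Equiv.Perm (Fin n), ((Equiv.Perm.sign σ : ℤˣ) : ℤ) * ∏ i, M i (σ i) := by
    -- Transposing makes the product run over rows, which are the independent objects.
    rw [← Matrix.det_transpose, Matrix.det_apply']
    simp
  rw [show M.det ^ 4 = M.det * (M.det * (M.det * M.det)) by ring]
  rw [h]
  simp_rw [Fintype.sum_prod_type, Finset.sum_mul_sum, ← Finset.mul_sum, signProd,
    Finset.prod_mul_distrib]
  refine Finset.sum_congr rfl fun a _ => ?_
  simp_rw [Finset.mul_sum]
  refine Finset.sum_congr rfl fun b _ => ?_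
  refine Finset.sum_congr rfl fun c _ => ?_
  refine Finset.sum_congr rfl fun d _ => ?_
  push_cast
  ring

/-- The fourth moment of a random determinant with independent rows, in terms of the fourth
moments of a single row. -/
lemma integral_det_pow_four {n : ℕ} (μ : Measure (EuclideanSpace ℝ (Fin n)))
    [IsProbabilityMeasure μ]
    (hint : ∀ a b c d : Fin n, Integrable (fun x => x a * x b * x c * x d) μ) :
    Integrable (fun x : Fin n → EuclideanSpace ℝ (Fin n) => (Matrix.of fun i j => x i j).det ^ 4)
      (Measure.pi fun _ => μ) ∧
    ∫ x : Fin n → EuclideanSpace ℝ (Fin n), (Matrix.of fun i j => x i j).det ^ 4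
        ∂(Measure.pi fun _ => μ) =
      ∑ σ : Equiv.Perm (Fin n) × Equiv.Perm (Fin n) × Equiv.Perm (Fin n) × Equiv.Perm (Fin n),
        signProd σ * ∏ i, ∫ x, x (σ.1 i) * x (σ.2.1 i) * x (σ.2.2.1 i) * x (σ.2.2.2 i) ∂μ := by
  have hσ : ∀ σ : Equiv.Perm (Fin n) × Equiv.Perm (Fin n) × Equiv.Perm (Fin n) ×
      Equiv.Perm (Fin n), Integrable (fun x : Fin n → EuclideanSpace ℝ (Fin n) => signProd σ *
        ∏ i, (x i (σ.1 i) * x i (σ.2.1 i) * x i (σ.2.2.1 i) * x i (σ.2.2.2 i)))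
        (Measure.pi fun _ => μ) := fun σ =>
    (Integrable.fintype_prod (μ := fun _ => μ)
      (f := fun i (x : EuclideanSpace ℝ (Fin n)) =>
        x (σ.1 i) * x (σ.2.1 i) * x (σ.2.2.1 i) * x (σ.2.2.2 i))
      fun i => hint _ _ _ _).const_mul _
  simp_rw [Matrix.det_pow_four_eq_sum, Matrix.of_apply]
  refine ⟨integrable_finsetSum _ fun σ _ => hσ σ, ?_⟩
  rw [integral_finsetSum _ fun σ _ => hσ σ]
  refine Finset.sum_congr rfl fun σ _ => ?_
  rw [integral_const_mul, integral_fintype_prod_eq_prod (μ := fun _ => μ)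
    (f := fun i (x : EuclideanSpace ℝ (Fin n)) =>
        x (σ.1 i) * x (σ.2.1 i) * x (σ.2.2.1 i) * x (σ.2.2.2 i))]

lemma symmPolytopeVol_pow_four {n : ℕ} [NeZero n] (K : Set (EuclideanSpace ℝ (Fin n)))
    (x : Fin n → EuclideanSpace ℝ (Fin n)) :
    symmPolytopeVol K x ^ 4 =
      16 ^ n / ((n.factorial : ℝ) ^ 4 * volume.real K ^ 4) *
        (Matrix.of fun i j => x i j).det ^ 4 := by
  rw [symmPolytopeVol, volume_real_convexHull_range_union_range_neg, div_pow, mul_pow, div_pow,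
    Even.pow_abs (by decide), ← pow_mul, mul_comm n 4, pow_mul]
  norm_num
  ring

lemma IsSymmConvexBody.integrable_cond {n : ℕ} {K : Set (EuclideanSpace ℝ (Fin n))}
    (hK : IsSymmConvexBody K) {g : EuclideanSpace ℝ (Fin n) → ℝ} (hg : Continuous g) :
    Integrable g (cond volume K) :=
  (hK.integrableOn_of_continuous hg).smul_measure (ENNReal.inv_ne_top.2 hK.volume_pos.ne')

lemma integral_cond_volume {n : ℕ} (K : Set (EuclideanSpace ℝ (Fin n)))
    (g : EuclideanSpace ℝ (Fin n) → ℝ) :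
    ∫ x, g x ∂(cond volume K) = (volume.real K)⁻¹ * ∫ x in K, g x := by
  rw [ProbabilityTheory.cond, integral_smul_measure, smul_eq_mul, ENNReal.toReal_inv, Measure.real]

theorem proposition3p1 {n : ℕ} (hn : 2 ≤ n) (K : Set (EuclideanSpace ℝ (Fin n)))
    (hK : IsSymmConvexBody K) (hsymm : IsOneSymmetric K)
    {Ω : Type*} [MeasurableSpace Ω] (P : Measure Ω) [IsProbabilityMeasure P]
    (X : Fin n → Ω → EuclideanSpace ℝ (Fin n))
    (hunif : ∀ i, pdf.IsUniform (X i) K P volume)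
    (hindep : iIndepFun X P) :
    0 < mixedMoment hn K ∧
    Integrable (fun ω => symmPolytopeVol K (fun i => X i ω) ^ 4) P ∧
    ∫ ω, symmPolytopeVol K (fun i => X i ω) ^ 4 ∂P =
      16 ^ n * ((n : ℝ) + 1) * ((n : ℝ) + 2) /
          (2 * (Nat.factorial n : ℝ) ^ 2 * volume.real K ^ (n + 4)) *
        mixedMoment hn K ^ n * truncExpPhi (momentRatio hn K - 3) n := by
  have : NeZero n := ⟨by omega⟩
  have hpos := hK.mixedMoment_pos hn
  have hfin : volume K ≠ ⊤ := hK.isCompact.measure_lt_top.ne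
  have hvol : 0 < volume.real K := ENNReal.toReal_pos hK.volume_pos.ne' hfin
  have hprob : IsProbabilityMeasure (cond volume K) :=
    cond_isProbabilityMeasure_of_finite hK.volume_pos.ne' hfin
  have hX : ∀ i, AEMeasurable (X i) P := fun i => (hunif i).aemeasurable hK.volume_pos.ne' hfin
  have hlaw : P.map (fun ω i => X i ω) = Measure.pi fun _ => cond volume K := by
    rw [(iIndepFun_iff_map_fun_eq_pi_map hX).1 hindep]
    congr 1
    funext i
    exact hunif i
  obtain ⟨hdet_int, hdet⟩ := integral_det_pow_four (cond volume K)
    fun a b c d => hK.integrable_cond (by fun_prop)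
  have hXm : AEMeasurable (fun ω i => X i ω) P := aemeasurable_pi_iff.2 hX
  rw [← hlaw] at hdet_int hdet
  rw [integral_map hXm hdet_int.aestronglyMeasurable] at hdet
  have hdet_int' := hdet_int.comp_aemeasurable hXm
  simp_rw [symmPolytopeVol_pow_four]
  refine ⟨hpos, hdet_int'.const_mul _, ?_⟩
  rw [integral_const_mul, hdet]
  simp_rw [integral_cond_volume, hsymm.moment_four hn hpos.ne', Finset.prod_mul_distrib,
    Finset.prod_const, Finset.card_univ, Fintype.card_fin, mul_left_comm (signProd _)]
  -- The `n` uniform densities supply `|K|⁻ⁿ`, which joins `|K|⁻⁴` from the normalization; `(n!)²`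
  -- cancels half of `(n!)⁴`.
  rw [← Finset.mul_sum, ← Finset.mul_sum, sum_signProd_prod_pattern, pow_add, inv_pow]
  field_simp
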